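/- Let $H$ be a real Hilbert space, let $N\ge 2$, and let $f_1,\dots,f_N:H\to\mathbb R\cup\{+\infty\}$ be proper, convex and lower semicontinuous, with $0\in(\partial f_1+\cdots+\partial f_N)(x)$ for some $x\in H$; here $\partial f_1+\cdots+\partial f_N$ is the pointwise Minkowski sum of the convex subdifferentials. Put $f=f_1+\cdots+f_N$. Let $(\mathcal N,\mathcal E,\mathcal E')$ be a bilevel graph on $\mathcal N=\{1,\dots,N\}$: $\mathcal E\subseteq\mathcal N\times\mathcal N$ is a set of directed edges such that $i<j$ for all $(i,j)\in\mathcal E$, $\mathcal E'\subseteq\mathcal E$, and both $(\mathcal N,\mathcal E)$ and $(\mathcal N,\mathcal E')$ are connected as undirected graphs. Let $d_i$ be the degree of node $i$ in $(\mathcal N,\mathcal E)$, let $L$ be the graph Laplacian of $(\mathcal N,\mathcal E')$, and let $Z\in\mathbb R^{N\times(N-1)}$ be injective with $L=ZZ^{*}$. Let $\sigma>0$, let $0<\epsilon<1$, let $\theta_k\in[\epsilon,2-\epsilon]$ for all $k\ge 0$, let $w^0=(w^0_1,\dots,w^0_{N-1})\in H^{N-1}$ be arbitrary, and let $x^{k+1}=(x_1^{k+1},\dots,x_N^{k+1})\in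 H^N$ and $w^{k+1}\in H^{N-1}$ be generated, for $k=0,1,2,\dots$, by the graph-based Douglas–Rachford method $$x_i^{k+1}=\Big(I+\tfrac{\sigma}{d_i}\partial f_i\Big)^{-1}\Big(\tfrac{2}{d_i}\sum_{(h,i)\in\mathcal E}x_h^{k+1}+\tfrac1{d_i}\sum_{j=1}^{N-1}Z_{ij}w_j^k\Big),\quad i=1,\dots,N,$$ $$w_j^{k+1}=w_j^k-\theta_k\sum_{i=1}^N Z_{ij}x_i^{k+1},\quad j=1,\dots,N-1.$$ Let $j\in\{1,\dots,N\}$ and suppose that, for every $i\ne j$, $f_i$ is finite everywhere and Lipschitz continuous on every bounded subset of $H$ (if $H$ is finite-dimensional, this says that $f_i$ is locally Lipschitz continuous on $H$). Then $\inf f\in\mathbb R$, $f(x_j^k)<+\infty$ for all $k\ge 1$, and $$f(x_j^k)-\inf f=o(k^{-1/2})\quad (k\to\infty).$$ If moreover $f_j$ is finite everywhere and Lipschitz continuous on every bounded subset of $H$, then, with $\bar x^k=\frac1N\sum_{i=1}^N x_i^k$, also $f(\bar x^k)<+\infty$ for all $k\ge1$ and $f(\bar x^k)-\inf f=o(k^{-1/2})$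 as $k\to\infty$. -/

import Mathlib

namespace GraphDRS

/-! ### Convex analysis for functions with values in `ℝ ∪ {+∞}` -/

section Convex

variable {H : Type*} [NormedAddCommGroup H] [InnerProductSpace ℝ H]

/-- `f : H → ℝ ∪ {+∞}` (a function into `EReal` that avoids `-∞`) is proper, convex and lower
semicontinuous. Convexity is convexity of the epigraph. -/
structure IsProperConvexLsc (f : H → EReal) : Prop where
  ne_bot : ∀ x, f x ≠ ⊥
  exists_ne_top : ∃ x, f x ≠ ⊤
  convex : Convex ℝ {p : H × ℝ | f p.1 ≤ (p.2 : EReal)}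
  lsc : LowerSemicontinuous f

/-- The convex subdifferential `∂f`. For proper `f` it is empty wherever `f x = +∞`. -/
def subdifferential (f : H → EReal) (x : H) : Set H :=
  {a | ∀ y, f x + ((inner ℝ a (y - x) : ℝ) : EReal) ≤ f y}

/-- The values of the resolvent `J_{τA} = (I + τA)⁻¹` of a set-valued operator `A` at `y`,
i.e. all `x` with `y ∈ x + τ A x`. -/
def resolvent (τ : ℝ) (A : H → Set H) (y : H) : Set H :=
  {x | ∃ a ∈ A x, x + τ • a = y}

/-- The zeros of the (pointwise Minkowski) sum `A_1 + ⋯ + A_N`. -/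
def zerSum {N : ℕ} (A : Fin N → H → Set H) : Set H :=
  {x | ∃ a : Fin N → H, (∀ i, a i ∈ A i x) ∧ ∑ i, a i = 0}

/-- `f` is finite everywhere and Lipschitz continuous on every bounded set. If `H` is
finite-dimensional, this is the same as being finite and locally Lipschitz on `H`. -/
def IsLipschitzOnBounded (f : H → EReal) : Prop :=
  ∃ g : H → ℝ, (∀ x, f x = (g x : EReal)) ∧
    ∀ s : Set H, Bornology.IsBounded s → ∃ K : NNReal, LipschitzOnWith K g s

/-- `F (y k) - inf F = o(k^{-1/2})` for `k → ∞`, where `inf F` is a real number and `F (y k)` is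
finite for every `k ≥ 1`. -/
def ObjectiveRate (F : H → EReal) (y : ℕ → H) : Prop :=
  (⨅ x, F x) ≠ ⊥ ∧ (⨅ x, F x) ≠ ⊤ ∧ (∀ k, 1 ≤ k → F (y k) ≠ ⊤) ∧
    (fun k : ℕ => (F (y k)).toReal - (⨅ x, F x).toReal)
      =o[Filter.atTop] (fun k : ℕ => (k : ℝ) ^ (-(1 / 2) : ℝ))

end Convex

/-! ### Bilevel graphs -/

noncomputable section Graphs

/-- The undirected graph of a set of directed edges: `i` and `j` are adjacent if `i ≠ j` and
`(i, j)` or `(j, i)` is an edge. -/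
def undirected {N : ℕ} (E : Finset (Fin N × Fin N)) : SimpleGraph (Fin N) :=
  SimpleGraph.fromRel (fun i j => (i, j) ∈ E)

/-- A bilevel graph on the nodes `{1, …, N}`: a connected, topologically ordered state graph and
a connected base graph on the same nodes whose edges are edges of the state graph. -/
structure BilevelGraph (N : ℕ) where
  stateEdges : Finset (Fin N × Fin N)
  baseEdges : Finset (Fin N × Fin N)
  topological : ∀ i j, (i, j) ∈ stateEdges → i < j
  base_subset : baseEdges ⊆ stateEdges
  state_connected : (undirected stateEdges).Connected
  base_connected : (undirected baseEdges).Connected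

namespace BilevelGraph

variable {N : ℕ} (G : BilevelGraph N)

open Classical in
/-- The degree `d_i` of node `i` in the state graph. -/
def stateDegree (i : Fin N) : ℕ := (undirected G.stateEdges).degree i

open Classical in
/-- The graph Laplacian of the base graph: degrees on the diagonal, `-1` for adjacent nodes and
`0` elsewhere. -/
def baseLaplacian : Matrix (Fin N) (Fin N) ℝ := (undirected G.baseEdges).lapMatrix ℝ

/-- `Z ∈ ℝ^{N × (N-1)}` is an onto decomposition of the Laplacian of the base graph:
`L = Z Zᵀ` with `Z` injective. -/
def IsOntoDecomposition (Z : Matrix (Fin N) (Fin (N - 1)) ℝ) : Prop :=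
  G.baseLaplacian = Z * Z.transpose ∧ Function.Injective Z.mulVec

end BilevelGraph

/-- `(w^k)` and `(x^k)` are generated by the graph-based Douglas–Rachford method for the operators
`A_1, …, A_N` with step size `σ` and relaxation parameters `θ_k`. The starting point `w 0` is
arbitrary, and the iterates `x k` are produced for `k ≥ 1` only (`x 0` plays no role). -/
structure IsGraphDRS {H : Type*} [NormedAddCommGroup H] [InnerProductSpace ℝ H] {N : ℕ}
    (G : BilevelGraph N) (Z : Matrix (Fin N) (Fin (N - 1)) ℝ) (A : Fin N → H → Set H)
    (σ : ℝ) (θ : ℕ → ℝ) (w : ℕ → Fin (N - 1) → H) (x : ℕ → Fin N → H) : Prop where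
  x_step : ∀ k i, x (k + 1) i ∈ resolvent (σ / (G.stateDegree i : ℝ)) (A i)
    ((2 / (G.stateDegree i : ℝ)) •
        (∑ h ∈ Finset.univ.filter (fun h => (h, i) ∈ G.stateEdges), x (k + 1) h)
      + (1 / (G.stateDegree i : ℝ)) • ∑ j, Z i j • w k j)
  w_step : ∀ k j, w (k + 1) j = w k j - θ k • ∑ i, Z i j • x (k + 1) i

end Graphs

end GraphDRS

/-! With `nodeMap` `= -d_i x_i + 2 ∑_{(h,i) ∈ E} x_h + (Z w)_i`, the method says that `nodeMap` at
`(w^k, x^{k+1})` is `σ a_i` with `a_i ∈ ∂f_i(x_i^{k+1})`. Pairing with `x` gives `⟨w, Zᵀx⟩` minus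
the state energy (`sum_inner_nodeMap`), and `‖Zᵀx‖²` is the base energy, which is smaller. Applied
to differences, monotonicity of the subdifferentials makes `w ↦ Zᵀx` firmly nonexpansive. Since the
range of `Z` is the zero-sum hyperplane, a zero `p` of the sum yields a fixed point
(`exists_fixed_point`). The residual norms `ρ_k = ‖Zᵀx^{k+1}‖` are then nonincreasing and square
summable, hence `o(k^{-1/2})` (`relaxed_iteration`).

Connectedness of the base graph bounds all `x_i - x_l` by `O(ρ_k)`. In `∑ a_i` the `w` terms cancel
and only edge differences remain, so this sum is `O(ρ_k)` too. For `y` within `O(ρ_k)` of all `x_i`,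
the subgradient inequalities give `f(y) - f(p) ≤ ∑ (f_i(y) - f_i(x_i)) + ∑ ⟨a_i, x_i - y⟩ + ⟨∑ a_i,
y - p⟩`, and every term is `O(ρ_k)`. The first needs a Lipschitz bound only for those `i` with `y ≠
x_i`. -/

namespace GraphDRS

/-! ### Dirichlet energies, Laplacians and the range of `Z`. -/

section Graph

variable {N : ℕ} {H : Type*} [NormedAddCommGroup H]

/-- The indicator of a set of directed edges. -/
noncomputable def edgeInd (E : Finset (Fin N × Fin N)) (i l : Fin N) : ℝ :=
  if (i, l) ∈ E then 1 else 0

/-- The Dirichlet energy of a vector of node values. -/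
noncomputable def energy (E : Finset (Fin N × Fin N)) (x : Fin N → H) : ℝ :=
  ∑ i, ∑ l, edgeInd E i l * ‖x i - x l‖ ^ 2

lemma edgeInd_nonneg (E : Finset (Fin N × Fin N)) (i l : Fin N) : 0 ≤ edgeInd E i l := by
  unfold edgeInd; split_ifs <;> norm_num

lemma energy_mono {E E' : Finset (Fin N × Fin N)} (h : E' ⊆ E) (x : Fin N → H) :
    energy E' x ≤ energy E x := by
  unfold energy
  gcongr with i _ l _
  unfold edgeInd
  split_ifs with h1 h2 h2
  · exact le_rfl
  · exact absurd (h h1) h2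
  · norm_num
  · exact le_rfl

lemma norm_sq_le_energy_of_mem {E : Finset (Fin N × Fin N)} {i l : Fin N} (h : (i, l) ∈ E)
    (x : Fin N → H) : ‖x i - x l‖ ^ 2 ≤ energy E x := by
  have h0 : ∀ i l, 0 ≤ edgeInd E i l * ‖x i - x l‖ ^ 2 := fun i l =>
    mul_nonneg (edgeInd_nonneg E i l) (sq_nonneg _)
  calc ‖x i - x l‖ ^ 2 = edgeInd E i l * ‖x i - x l‖ ^ 2 := by simp [edgeInd, h]
    _ ≤ ∑ l, edgeInd E i l * ‖x i - x l‖ ^ 2 :=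
        Finset.single_le_sum (fun l _ => h0 i l) (Finset.mem_univ l)
    _ ≤ _ := Finset.single_le_sum (f := fun i => ∑ l, edgeInd E i l * ‖x i - x l‖ ^ 2)
        (fun i _ => Finset.sum_nonneg fun l _ => h0 i l) (Finset.mem_univ i)

variable [InnerProductSpace ℝ H]

/-- Cross terms are charged to the head of each edge, matching the incoming sums in the method. -/
lemma energy_eq (E : Finset (Fin N × Fin N)) (x : Fin N → H) :
    energy E x = ∑ i, ∑ l, ((edgeInd E i l + edgeInd E l i) * ‖x i‖ ^ 2
      - 2 * (edgeInd E l i * inner ℝ (x l) (x i))) := by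
  have h : ∑ i, ∑ l, edgeInd E l i * (‖x i‖ ^ 2 - 2 * inner ℝ (x l) (x i)) =
      ∑ i, ∑ l, edgeInd E i l * (‖x l‖ ^ 2 - 2 * inner ℝ (x i) (x l)) := Finset.sum_comm
  calc energy E x = ∑ i, ∑ l, edgeInd E i l * ‖x i‖ ^ 2 +
        ∑ i, ∑ l, edgeInd E i l * (‖x l‖ ^ 2 - 2 * inner ℝ (x i) (x l)) := by
        simp only [energy, ← Finset.sum_add_distrib]
        refine Finset.sum_congr rfl fun i _ => Finset.sum_congr rfl fun l _ => ?_
        rw [norm_sub_sq_real]; ring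
    _ = _ := by
        rw [← h]
        simp only [← Finset.sum_add_distrib]
        refine Finset.sum_congr rfl fun i _ => Finset.sum_congr rfl fun l _ => ?_
        ring

/-- The topological order excludes opposite edges, so the right-hand side never equals 2. -/
lemma ite_undirected_adj {E : Finset (Fin N × Fin N)} (hE : ∀ i j, (i, j) ∈ E → i < j)
    (i l : Fin N) [Decidable ((undirected E).Adj i l)] :
    (if (undirected E).Adj i l then (1 : ℝ) else 0) = edgeInd E i l + edgeInd E l i := by
  have h : (undirected E).Adj i l ↔ i ≠ l ∧ ((i, l) ∈ E ∨ (l, i) ∈ E) := by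
    simp [undirected, SimpleGraph.fromRel_adj]
  unfold edgeInd
  by_cases h1 : (i, l) ∈ E
  · have h2 : (l, i) ∉ E := fun h2 => lt_asymm (hE _ _ h1) (hE _ _ h2)
    have h3 : i ≠ l := (hE _ _ h1).ne
    rw [if_pos (h.2 ⟨h3, Or.inl h1⟩)]
    simp [h1, h2]
  · by_cases h2 : (l, i) ∈ E
    · have h3 : i ≠ l := (hE _ _ h2).ne'
      rw [if_pos (h.2 ⟨h3, Or.inr h2⟩)]
      simp [h1, h2]
    · rw [if_neg (by rw [h]; tauto)]
      simp [h1, h2]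

lemma degree_eq_sum_edgeInd {E : Finset (Fin N × Fin N)} (hE : ∀ i j, (i, j) ∈ E → i < j)
    (i : Fin N) [Fintype ((undirected E).neighborSet i)] :
    ((undirected E).degree i : ℝ) = ∑ l, (edgeInd E i l + edgeInd E l i) := by
  classical
  simp_rw [← ite_undirected_adj hE]
  rw [Finset.sum_boole, ← SimpleGraph.card_neighborFinset_eq_degree]
  congr 2
  ext; simp

lemma lapMatrix_apply {E : Finset (Fin N × Fin N)} (hE : ∀ i j, (i, j) ∈ E → i < j)
    [DecidableRel (undirected E).Adj] (i l : Fin N) :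
    (undirected E).lapMatrix ℝ i l =
      (if i = l then ∑ m, (edgeInd E i m + edgeInd E m i) else 0)
        - (edgeInd E i l + edgeInd E l i) := by
  rw [SimpleGraph.lapMatrix, Matrix.sub_apply, SimpleGraph.adjMatrix_apply,
    ite_undirected_adj hE, SimpleGraph.degMatrix, Matrix.diagonal_apply,
    degree_eq_sum_edgeInd hE]

lemma sum_lapMatrix_inner {E : Finset (Fin N × Fin N)} (hE : ∀ i j, (i, j) ∈ E → i < j)
    [DecidableRel (undirected E).Adj] (x : Fin N → H) :
    ∑ i, ∑ l, (undirected E).lapMatrix ℝ i l * inner ℝ (x i) (x l) = energy E x := by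
  simp only [lapMatrix_apply hE, sub_mul, ite_mul, zero_mul, Finset.sum_sub_distrib,
    Finset.sum_ite_eq, Finset.mem_univ, if_true, real_inner_self_eq_norm_sq, energy_eq,
    Finset.sum_mul]
  congr 1
  have h : ∑ i, ∑ l, edgeInd E i l * inner ℝ (x i) (x l) =
      ∑ i, ∑ l, edgeInd E l i * inner ℝ (x l) (x i) := Finset.sum_comm
  simp only [add_mul, Finset.sum_add_distrib, h, two_mul]
  simp only [real_inner_comm]

namespace BilevelGraph

variable {G : BilevelGraph N} {Z : Matrix (Fin N) (Fin (N - 1)) ℝ}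

/-- `‖Zᵀx‖² = ⟨x, Z Zᵀ x⟩ = ⟨x, L x⟩`. -/
lemma IsOntoDecomposition.sum_norm_sq (hZ : G.IsOntoDecomposition Z) (x : Fin N → H) :
    ∑ j, ‖∑ i, Z i j • x i‖ ^ 2 = energy G.baseEdges x := by
  classical
  rw [← sum_lapMatrix_inner fun i j h => G.topological i j (G.base_subset h)]
  have h : ∀ i l, (undirected G.baseEdges).lapMatrix ℝ i l = ∑ j, Z i j * Z l j := by
    intro i l
    have := congrFun (congrFun hZ.1 i) l
    rw [Matrix.mul_apply] at this
    simp only [Matrix.transpose_apply] at this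
    rw [← this, baseLaplacian]
  simp_rw [h, ← real_inner_self_eq_norm_sq, sum_inner, inner_sum, real_inner_smul_left,
    real_inner_smul_right, Finset.sum_mul]
  rw [Finset.sum_comm]
  refine Finset.sum_congr rfl fun i _ => ?_
  rw [Finset.sum_comm]
  refine Finset.sum_congr rfl fun i _ => Finset.sum_congr rfl fun i _ => ?_
  ring

/-- Constant vectors have zero energy, so `Zᵀ` kills them. -/
lemma IsOntoDecomposition.sum_col (hZ : G.IsOntoDecomposition Z) (j : Fin (N - 1)) :
    ∑ i, Z i j = 0 := by
  have h := hZ.sum_norm_sq (fun _ => (1 : ℝ))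
  simp only [energy, sub_self, norm_zero, ne_eq, OfNat.ofNat_ne_zero, not_false_eq_true,
    zero_pow, mul_zero, Finset.sum_const_zero, smul_eq_mul, mul_one] at h
  have := (Finset.sum_eq_zero_iff_of_nonneg (fun i _ => sq_nonneg _)).1 h j (Finset.mem_univ j)
  simpa using this

/-- A vector with zero sum is in the range of the decomposition. -/
lemma IsOntoDecomposition.exists_eq_sum (hN : 2 ≤ N) (hZ : G.IsOntoDecomposition Z)
    (v : Fin N → H) (hv : ∑ i, v i = 0) :
    ∃ w : Fin (N - 1) → H, ∀ i, ∑ j, Z i j • w j = v i := by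
  classical
  let φ : (Fin N → ℝ) →ₗ[ℝ] ℝ := ∑ i, LinearMap.proj i
  have hφ : ∀ u, φ u = ∑ i, u i := fun u => by simp [φ]
  let o : Fin N := ⟨0, by omega⟩
  have hsurj : Function.Surjective φ := fun t => ⟨Pi.single o t, by simp [hφ]⟩
  have hker : Module.finrank ℝ (LinearMap.ker φ) = N - 1 := by
    have := LinearMap.finrank_range_add_finrank_ker φ
    rw [LinearMap.range_eq_top.2 hsurj, finrank_top, Module.finrank_self,
      Module.finrank_fin_fun] at this
    omega
  have hran : Module.finrank ℝ (LinearMap.range Z.mulVecLin) = N - 1 := by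
    rw [LinearMap.finrank_range_of_inj hZ.2, Module.finrank_fin_fun]
  have hle : LinearMap.range Z.mulVecLin ≤ LinearMap.ker φ := by
    rintro _ ⟨c, rfl⟩
    rw [LinearMap.mem_ker, hφ]
    simp only [Matrix.mulVecLin_apply, Matrix.mulVec, dotProduct]
    rw [Finset.sum_comm]
    simp [← Finset.sum_mul, hZ.sum_col]
  -- Over `ℝ`, the range of `Z` is the whole zero-sum hyperplane: both have dimension `N - 1`.
  have heq := Submodule.eq_of_le_of_finrank_eq hle (hran.trans hker.symm)
  have hc : ∀ i, ∃ c, Z.mulVec c = Pi.single i 1 - Pi.single o 1 := by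
    intro i
    have : (Pi.single i 1 - Pi.single o 1 : Fin N → ℝ) ∈ LinearMap.range Z.mulVecLin := by
      rw [heq, LinearMap.mem_ker, hφ]
      simp
    exact this
  choose c hc using hc
  -- Lift to `H`: because `∑ v_i = 0`, `v = ∑ e_i ⊗ v_i = ∑ (e_i - e_o) ⊗ v_i`, and `c i` is a
  -- preimage of `e_i - e_o`.
  refine ⟨fun j => ∑ i, c i j • v i, fun l => ?_⟩
  have h1 : ∀ i, ∑ j, Z l j * c i j = (Pi.single i 1 - Pi.single o 1 : Fin N → ℝ) l :=
    fun i => congrFun (hc i) l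
  simp_rw [Finset.smul_sum, smul_smul]
  rw [Finset.sum_comm]
  simp_rw [← Finset.sum_smul, h1, Pi.sub_apply, sub_smul, Finset.sum_sub_distrib,
    ← Finset.smul_sum, hv]
  simp [Pi.single_apply]

lemma stateDegree_eq (i : Fin N) : (G.stateDegree i : ℝ) =
    ∑ l, (edgeInd G.stateEdges i l + edgeInd G.stateEdges l i) := by
  classical
  exact degree_eq_sum_edgeInd G.topological i

lemma stateDegree_pos (hN : 2 ≤ N) (i : Fin N) : 0 < (G.stateDegree i : ℝ) := by
  classical
  have : Nontrivial (Fin N) := Fin.nontrivial_iff_two_le.2 hN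
  have := G.state_connected.preconnected.degree_pos_of_nontrivial i
  unfold stateDegree
  exact_mod_cast (by convert this)

omit [InnerProductSpace ℝ H] in
/-- Differences of node values are controlled by the base energy. -/
lemma norm_sub_le_of_energy_le (x : Fin N → H) {ρ : ℝ} (hρ : 0 ≤ ρ)
    (h : energy G.baseEdges x ≤ ρ ^ 2) (i l : Fin N) : ‖x i - x l‖ ≤ N * ρ := by
  classical
  have hadj : ∀ i l, (undirected G.baseEdges).Adj i l → ‖x i - x l‖ ≤ ρ := by
    intro i l hil
    rw [undirected, SimpleGraph.fromRel_adj] at hil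
    refine abs_le_of_sq_le_sq' ?_ hρ |>.2
    rcases hil.2 with h' | h'
    · exact (norm_sq_le_energy_of_mem h' x).trans h
    · rw [norm_sub_rev]
      exact (norm_sq_le_energy_of_mem h' x).trans h
  have hwalk : ∀ {i l} (p : (undirected G.baseEdges).Walk i l), ‖x i - x l‖ ≤ p.length * ρ := by
    intro i l p
    induction p with
    | nil => simp
    | @cons u v w huv p ih =>
      have := norm_sub_le_norm_sub_add_norm_sub (x u) (x v) (x w)
      have := hadj u v huv
      rw [SimpleGraph.Walk.length_cons]
      push_cast
      linarith
  obtain ⟨p, hp⟩ := (G.base_connected.preconnected i l).exists_isPath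
  refine (hwalk p).trans ?_
  have := hp.length_lt
  rw [Fintype.card_fin] at this
  gcongr

end BilevelGraph

end Graph

end GraphDRS

namespace GraphDRS

open Filter Asymptotics

/-! ### Relaxed iterations with a firmly nonexpansive residual. -/

section Relaxation

/-- By monotonicity `k a_k` is at most twice the block sum of `a` over `[k/2, k)`, a difference of
convergent partial sums. -/
lemma tendsto_nat_mul_of_antitone_of_summable {a : ℕ → ℝ} (ha : Antitone a) (h0 : ∀ k, 0 ≤ a k)
    (hs : Summable a) : Tendsto (fun k : ℕ => (k : ℝ) * a k) atTop (nhds 0) := by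
  have hS := hs.hasSum.tendsto_sum_nat
  have hhalf : Tendsto (fun k : ℕ => k / 2) atTop atTop :=
    Nat.tendsto_div_const_atTop two_ne_zero
  have hdiff := (hS.sub (hS.comp hhalf)).const_mul 2
  rw [sub_self, mul_zero] at hdiff
  refine squeeze_zero (fun k => mul_nonneg k.cast_nonneg (h0 k)) (fun k => ?_) hdiff
  have h1 : ((k - k / 2 : ℕ) : ℝ) * a k ≤ ∑ i ∈ Finset.Ico (k / 2) k, a i := by
    rw [← nsmul_eq_mul, ← Nat.card_Ico]
    exact Finset.card_nsmul_le_sum _ _ _ fun i hi => ha (Finset.mem_Ico.1 hi).2.le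
  rw [Finset.sum_Ico_eq_sub _ (Nat.div_le_self k 2)] at h1
  have h2 : (k : ℝ) ≤ 2 * ((k - k / 2 : ℕ) : ℝ) := by
    exact_mod_cast (show k ≤ 2 * (k - k / 2) by omega)
  have h3 := mul_le_mul_of_nonneg_right h2 (h0 k)
  simp only [Function.comp_apply]
  linarith

variable {V : Type*} [NormedAddCommGroup V] [InnerProductSpace ℝ V]

/-- Expanding the square leaves a decrease of `t (2 - t) ‖r‖²`, and both factors are at least `ε`.
-/
lemma norm_relaxed_sub_sq_le {w r z : V} {ε t : ℝ} (hε0 : 0 < ε)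
    (ht : t ∈ Set.Icc ε (2 - ε)) (hr : ‖r‖ ^ 2 ≤ inner ℝ (w - z) r) :
    ‖w - t • r - z‖ ^ 2 + ε ^ 2 * ‖r‖ ^ 2 ≤ ‖w - z‖ ^ 2 := by
  have h : ‖w - t • r - z‖ ^ 2 = ‖w - z‖ ^ 2 - 2 * t * inner ℝ (w - z) r + t ^ 2 * ‖r‖ ^ 2 := by
    rw [show w - t • r - z = (w - z) - t • r by abel, norm_sub_sq_real, inner_smul_right,
      norm_smul, mul_pow, Real.norm_eq_abs, sq_abs]
    ring
  rw [h]
  have h1 : ε * ε ≤ t * (2 - t) :=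
    mul_le_mul ht.1 (by linarith [ht.2]) hε0.le (by linarith [ht.1])
  have h2 := mul_le_mul_of_nonneg_right h1 (sq_nonneg ‖r‖)
  have h3 := mul_le_mul_of_nonneg_left hr (show 0 ≤ 2 * t by linarith [ht.1])
  nlinarith

/-- Firm nonexpansiveness along one step gives `‖r' - r‖² ≤ -t ⟨r, r' - r⟩`; as `t ≤ 2`, this makes
`‖r'‖² - ‖r‖² = 2⟨r, r' - r⟩ + ‖r' - r‖²` nonpositive. -/
lemma norm_residual_le {w r r' : V} {t : ℝ} (ht0 : 0 < t) (ht : t ≤ 2)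
    (h : ‖r' - r‖ ^ 2 ≤ inner ℝ (w - t • r - w) (r' - r)) : ‖r'‖ ≤ ‖r‖ := by
  have h1 : (inner ℝ (w - t • r - w) (r' - r) : ℝ) = -(t * inner ℝ r (r' - r)) := by
    rw [show w - t • r - w = -(t • r) by abel, inner_neg_left, real_inner_smul_left]
  rw [h1] at h
  have h2 : ‖r'‖ ^ 2 = ‖r‖ ^ 2 + 2 * inner ℝ r (r' - r) + ‖r' - r‖ ^ 2 := by
    rw [← norm_add_sq_real]; congr 2; abel
  have h3 : t * (2 * inner ℝ r (r' - r) + ‖r' - r‖ ^ 2) ≤ 0 := by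
    nlinarith [sq_nonneg ‖r' - r‖]
  have h4 : 2 * inner ℝ r (r' - r) + ‖r' - r‖ ^ 2 ≤ 0 := by
    by_contra h5
    push Not at h5
    linarith [mul_pos ht0 h5]
  exact le_of_sq_le_sq (by linarith) (norm_nonneg _)

/-- The relaxed fixed point iteration of a firmly nonexpansive residual stays bounded, and the
norm of its residual is `o(k^{-1/2})`. -/
lemma relaxed_iteration {w r : ℕ → V} {z : V} {ε : ℝ} {θ : ℕ → ℝ} (hε0 : 0 < ε)
    (hθ : ∀ k, θ k ∈ Set.Icc ε (2 - ε)) (hw : ∀ k, w (k + 1) = w k - θ k • r k)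
    (hr : ∀ k l, ‖r k - r l‖ ^ 2 ≤ inner ℝ (w k - w l) (r k - r l))
    (hz : ∀ k, ‖r k‖ ^ 2 ≤ inner ℝ (w k - z) (r k)) :
    (∀ k, ‖w k - z‖ ≤ ‖w 0 - z‖) ∧
      (fun k => ‖r k‖) =o[atTop] (fun k : ℕ => ((k + 1 : ℕ) : ℝ) ^ (-(1 / 2) : ℝ)) := by
  have hstep : ∀ k, ‖w (k + 1) - z‖ ^ 2 + ε ^ 2 * ‖r k‖ ^ 2 ≤ ‖w k - z‖ ^ 2 := fun k => by
    rw [hw]; exact norm_relaxed_sub_sq_le hε0 (hθ k) (hz k)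
  have hanti : Antitone fun k => ‖w k - z‖ := antitone_nat_of_succ_le fun k =>
    le_of_sq_le_sq (by nlinarith [hstep k, sq_nonneg (ε * ‖r k‖)]) (norm_nonneg _)
  have hres : Antitone fun k => ‖r k‖ ^ 2 := antitone_nat_of_succ_le fun k => by
    have h := hr (k + 1) k
    rw [hw] at h
    have := norm_residual_le (by linarith [(hθ k).1]) (by linarith [(hθ k).2]) h
    gcongr
  have hsum : Summable fun k => ‖r k‖ ^ 2 := by
    have hb : ∀ n, ∑ k ∈ Finset.range n, ε ^ 2 * ‖r k‖ ^ 2 ≤ ‖w 0 - z‖ ^ 2 - ‖w n - z‖ ^ 2 := by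
      intro n
      induction n with
      | zero => simp
      | succ n ih => rw [Finset.sum_range_succ]; linarith [hstep n]
    refine summable_of_sum_range_le (c := ‖w 0 - z‖ ^ 2 / ε ^ 2) (fun _ => sq_nonneg _) fun n => ?_
    rw [le_div_iff₀ (by positivity), mul_comm, Finset.mul_sum]
    linarith [hb n, sq_nonneg ‖w n - z‖]
  refine ⟨fun k => hanti (Nat.zero_le k), ?_⟩
  have hlim : Tendsto (fun k : ℕ => ((k + 1 : ℕ) : ℝ) * ‖r k‖ ^ 2) atTop (nhds 0) := by
    have h1 : Tendsto (fun k : ℕ => (k : ℝ) * ‖r k‖ ^ 2) atTop (nhds 0) :=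
      tendsto_nat_mul_of_antitone_of_summable hres (fun _ => sq_nonneg _) hsum
    simpa [add_mul] using h1.add hsum.tendsto_atTop_zero
  rw [isLittleO_iff_tendsto' (Eventually.of_forall fun k hk => absurd hk (by positivity))]
  have h2 := (Real.continuous_sqrt.tendsto 0).comp hlim
  rw [Real.sqrt_zero] at h2
  refine h2.congr fun k => ?_
  have hk : (0 : ℝ) ≤ ((k + 1 : ℕ) : ℝ) := by positivity
  rw [Function.comp_apply, Real.sqrt_mul hk, Real.sqrt_sq (norm_nonneg _), Real.rpow_neg hk,
    div_inv_eq_mul, Real.sqrt_eq_rpow, mul_comm]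

end Relaxation

/-! ### Subgradient inequalities and the passage from `EReal` to real objective gaps. -/

section Convex

variable {H : Type*} [NormedAddCommGroup H] [InnerProductSpace ℝ H]

lemma ne_top_of_mem_subdifferential {f : H → EReal} (hf : IsProperConvexLsc f) {x a : H}
    (ha : a ∈ subdifferential f x) : f x ≠ ⊤ := by
  obtain ⟨y, hy⟩ := hf.exists_ne_top
  intro hx
  have := ha y
  rw [hx, EReal.top_add_coe, top_le_iff] at this
  exact hy this

lemma toReal_add_inner_le {f : H → EReal} (hf : IsProperConvexLsc f) {x a y : H}
    (ha : a ∈ subdifferential f x) (hy : f y ≠ ⊤) :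
    (f x).toReal + inner ℝ a (y - x) ≤ (f y).toReal := by
  have := ha y
  rw [← EReal.coe_toReal (ne_top_of_mem_subdifferential hf ha) (hf.ne_bot x),
    ← EReal.coe_toReal hy (hf.ne_bot y)] at this
  exact_mod_cast this

lemma subdifferential_monotone {f : H → EReal} (hf : IsProperConvexLsc f) {x y a b : H}
    (ha : a ∈ subdifferential f x) (hb : b ∈ subdifferential f y) :
    0 ≤ (inner ℝ (a - b) (x - y) : ℝ) := by
  have h1 := toReal_add_inner_le hf ha (ne_top_of_mem_subdifferential hf hb)
  have h2 := toReal_add_inner_le hf hb (ne_top_of_mem_subdifferential hf ha)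
  rw [← neg_sub x y, inner_neg_right] at h1
  rw [inner_sub_left]
  linarith

variable {N : ℕ}

/-- A zero of the sum of the subdifferentials minimizes the sum. -/
lemma sum_le_sum_of_sum_eq_zero {f : Fin N → H → EReal} {x : H} {b : Fin N → H}
    (hb : ∀ i, b i ∈ subdifferential (f i) x) (hb0 : ∑ i, b i = 0) (y : H) :
    ∑ i, f i x ≤ ∑ i, f i y := by
  have h : ∑ i, ((inner ℝ (b i) (y - x) : ℝ) : EReal) = 0 := by
    have : ((∑ i, (inner ℝ (b i) (y - x) : ℝ) : ℝ) : EReal) = 0 := by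
      rw [← sum_inner, hb0, inner_zero_left, EReal.coe_zero]
    rw [← this]
    exact (map_sum (⟨⟨Real.toEReal, EReal.coe_zero⟩, EReal.coe_add⟩ : ℝ →+ EReal) _ _).symm
  calc ∑ i, f i x = ∑ i, (f i x + ((inner ℝ (b i) (y - x) : ℝ) : EReal)) := by
        rw [Finset.sum_add_distrib, h, add_zero]
    _ ≤ _ := Finset.sum_le_sum fun i _ => hb i y

lemma coe_sum_toReal {f : Fin N → H → EReal} (hf : ∀ i, IsProperConvexLsc (f i)) {y : H}
    (hy : ∀ i, f i y ≠ ⊤) : ∑ i, f i y = ((∑ i, (f i y).toReal : ℝ) : EReal) := by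
  rw [show ((∑ i, (f i y).toReal : ℝ) : EReal) = ∑ i, ((f i y).toReal : EReal) from
    map_sum (⟨⟨Real.toEReal, EReal.coe_zero⟩, EReal.coe_add⟩ : ℝ →+ EReal) _ _]
  exact Finset.sum_congr rfl fun i _ => (EReal.coe_toReal (hy i) ((hf i).ne_bot y)).symm

/-- If the objective gap is controlled by a residual of order `o(k^{-1/2})`, then the objective
rate holds. -/
lemma objectiveRate_of_gap_le {f : Fin N → H → EReal} (hf : ∀ i, IsProperConvexLsc (f i)) {p : H}
    {b : Fin N → H} (hb : ∀ i, b i ∈ subdifferential (f i) p) (hb0 : ∑ i, b i = 0) {y : ℕ → H}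
    {ρ : ℕ → ℝ} {C : ℝ} (hy : ∀ k i, f i (y (k + 1)) ≠ ⊤)
    (hρ : ρ =o[atTop] (fun k : ℕ => ((k + 1 : ℕ) : ℝ) ^ (-(1 / 2) : ℝ)))
    (h : ∀ k, ∑ i, (f i (y (k + 1))).toReal - ∑ i, (f i p).toReal ≤ C * ρ k) :
    ObjectiveRate (fun z => ∑ i, f i z) y := by
  have hp : ∀ i, f i p ≠ ⊤ := fun i => ne_top_of_mem_subdifferential (hf i) (hb i)
  have hmin := sum_le_sum_of_sum_eq_zero hb hb0
  have hinf : (⨅ z, ∑ i, f i z) = ((∑ i, (f i p).toReal : ℝ) : EReal) := by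
    rw [← coe_sum_toReal hf hp]
    exact le_antisymm (iInf_le _ p) (le_iInf hmin)
  refine ⟨?_, ?_, ?_, ?_⟩
  · rw [hinf]; exact EReal.coe_ne_bot _
  · rw [hinf]; exact EReal.coe_ne_top _
  · rintro (_ | k) hk
    · omega
    · simp only [coe_sum_toReal hf (hy k)]; exact EReal.coe_ne_top _
  -- Residual `k` belongs to iterate `k + 1`, hence the shift by one.
  · rw [hinf, ← Filter.map_add_atTop_eq_nat 1, isLittleO_map]
    refine (IsBigO.of_bound |C| (Eventually.of_forall fun k => ?_)).trans_isLittleO hρ.norm_left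
    have h0 := hmin (y (k + 1))
    rw [coe_sum_toReal hf hp, coe_sum_toReal hf (hy k), EReal.coe_le_coe_iff] at h0
    simp only [Function.comp_apply, coe_sum_toReal hf (hy k), EReal.toReal_coe, Real.norm_eq_abs,
      abs_abs]
    rw [abs_of_nonneg (by linarith), ← abs_mul]
    exact (h k).trans (le_abs_self _)

end Convex

end GraphDRS

namespace GraphDRS

open Filter Asymptotics

/-! ### The node inclusions: pairing, sum, bounds and fixed points. -/

section Iteration

variable {N : ℕ} {H : Type*} [NormedAddCommGroup H] [InnerProductSpace ℝ H]

/-- The right-hand side of the node inclusions `σ ∂f_i(x_i) ∋ ⋯` of the method. -/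
noncomputable def nodeMap (G : BilevelGraph N) (Z : Matrix (Fin N) (Fin (N - 1)) ℝ)
    (w : Fin (N - 1) → H) (x : Fin N → H) (i : Fin N) : H :=
  -((G.stateDegree i : ℝ) • x i) + (2 : ℝ) • ∑ h, edgeInd G.stateEdges h i • x h
    + ∑ j, Z i j • w j

variable {G : BilevelGraph N} {Z : Matrix (Fin N) (Fin (N - 1)) ℝ}

lemma nodeMap_sub (w w' : Fin (N - 1) → H) (x x' : Fin N → H) (i : Fin N) :
    nodeMap G Z (w - w') (x - x') i = nodeMap G Z w x i - nodeMap G Z w' x' i := by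
  simp only [nodeMap, Pi.sub_apply, smul_sub, Finset.sum_sub_distrib]
  abel

/-- The degree terms and the doubled incoming sums complete one square `-‖x_i - x_l‖²` per state
edge. -/
lemma sum_inner_nodeMap (w : Fin (N - 1) → H) (x : Fin N → H) :
    ∑ i, inner ℝ (nodeMap G Z w x i) (x i) =
      ∑ j, inner ℝ (w j) (∑ i, Z i j • x i) - energy G.stateEdges x := by
  have h : ∑ j, inner ℝ (w j) (∑ i, Z i j • x i) = ∑ i, ∑ j, Z i j * inner ℝ (w j) (x i) := by
    simp only [inner_sum, real_inner_smul_right]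
    exact Finset.sum_comm
  rw [h, energy_eq, ← Finset.sum_sub_distrib]
  refine Finset.sum_congr rfl fun i _ => ?_
  simp only [nodeMap, inner_add_left, inner_neg_left, real_inner_smul_left, sum_inner,
    real_inner_self_eq_norm_sq, BilevelGraph.stateDegree_eq, Finset.sum_sub_distrib,
    ← Finset.sum_mul, ← Finset.mul_sum]
  ring

/-- The columns of `Z` sum to zero, so `w` drops out; an edge `(i, l)` contributes `2 x_i - x_i -
x_l`. -/
lemma sum_nodeMap (hZ : G.IsOntoDecomposition Z) (w : Fin (N - 1) → H) (x : Fin N → H) :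
    ∑ i, nodeMap G Z w x i = ∑ i, ∑ l, edgeInd G.stateEdges i l • (x i - x l) := by
  have h1 : ∑ i, ∑ j, Z i j • w j = 0 := by
    rw [Finset.sum_comm]
    simp [← Finset.sum_smul, hZ.sum_col]
  have h2 : ∑ i, ∑ l, edgeInd G.stateEdges l i • x i = ∑ i, ∑ l, edgeInd G.stateEdges i l • x l :=
    Finset.sum_comm
  have h3 : ∑ i, ∑ l, edgeInd G.stateEdges l i • x l = ∑ i, ∑ l, edgeInd G.stateEdges i l • x i :=
    Finset.sum_comm
  simp only [nodeMap, Finset.sum_add_distrib, h1, BilevelGraph.stateDegree_eq, add_smul,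
    Finset.sum_smul, Finset.sum_neg_distrib, h2, h3, smul_sub,
    Finset.sum_sub_distrib, two_smul]
  abel

lemma norm_sum_nodeMap_le (hZ : G.IsOntoDecomposition Z) (w : Fin (N - 1) → H) (x : Fin N → H)
    {c : ℝ} (hx : ∀ i l, ‖x i - x l‖ ≤ c) : ‖∑ i, nodeMap G Z w x i‖ ≤ N * (N * c) := by
  rw [sum_nodeMap hZ]
  have h : ∀ i l, ‖edgeInd G.stateEdges i l • (x i - x l)‖ ≤ c := fun i l => by
    have hc := (norm_nonneg _).trans (hx i l)
    unfold edgeInd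
    split_ifs
    · simpa using hx i l
    · simpa using hc
  calc _ ≤ ∑ _i : Fin N, ∑ _l : Fin N, c :=
        norm_sum_le_of_le _ fun i _ => norm_sum_le_of_le _ fun l _ => h i l
    _ = _ := by simp

/-- Used to bound the subgradients through the node inclusions, without any Lipschitz assumption. -/
lemma exists_norm_nodeMap_le (G : BilevelGraph N) (Z : Matrix (Fin N) (Fin (N - 1)) ℝ) :
    ∃ C, 0 ≤ C ∧ ∀ (w : Fin (N - 1) → H) (x : Fin N → H) (B : ℝ), (∀ j, ‖w j‖ ≤ B) →
      (∀ i, ‖x i‖ ≤ B) → ∀ i, ‖nodeMap G Z w x i‖ ≤ C * B := by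
  let c : Fin N → ℝ := fun i =>
    (G.stateDegree i : ℝ) + 2 * ∑ h, edgeInd G.stateEdges h i + ∑ j, |Z i j|
  have hc : ∀ i, 0 ≤ c i := fun i => by
    have := Finset.sum_nonneg fun h (_ : h ∈ Finset.univ) => edgeInd_nonneg G.stateEdges h i
    positivity
  refine ⟨∑ i, c i, Finset.sum_nonneg fun i _ => hc i, fun w x B hw hx i => ?_⟩
  have hB := (norm_nonneg _).trans (hx i)
  refine le_trans ?_ (mul_le_mul_of_nonneg_right
    (Finset.single_le_sum (fun i _ => hc i) (Finset.mem_univ i)) hB)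
  simp only [c, add_mul, mul_assoc, Finset.sum_mul]
  refine (norm_add₃_le).trans ?_
  rw [norm_neg, norm_smul, norm_smul, Real.norm_natCast, Real.norm_ofNat]
  gcongr
  · exact hx i
  · refine norm_sum_le_of_le _ fun h _ => ?_
    rw [norm_smul, Real.norm_of_nonneg (edgeInd_nonneg _ _ _)]
    exact mul_le_mul_of_nonneg_left (hx h) (edgeInd_nonneg _ _ _)
  · refine norm_sum_le_of_le _ fun j _ => ?_
    rw [norm_smul, Real.norm_eq_abs]
    exact mul_le_mul_of_nonneg_left (hw j) (abs_nonneg _)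

/-- The first node has no incoming edges, so that its value is controlled by `w` alone. -/
lemma exists_norm_first_le (hN : 2 ≤ N) (G : BilevelGraph N)
    (Z : Matrix (Fin N) (Fin (N - 1)) ℝ) :
    ∃ o : Fin N, ∃ C, 0 ≤ C ∧ ∀ (w : Fin (N - 1) → H) (x : Fin N → H) (B : ℝ),
      (∀ j, ‖w j‖ ≤ B) → 0 ≤ (inner ℝ (nodeMap G Z w x o) (x o) : ℝ) → ‖x o‖ ≤ C * B := by
  let o : Fin N := ⟨0, by omega⟩
  have ho : ∀ h, edgeInd G.stateEdges h o = 0 := fun h => by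
    rw [edgeInd, if_neg]
    intro hm
    exact absurd (G.topological _ _ hm) (by simp [o, Fin.lt_def])
  have hd := BilevelGraph.stateDegree_pos (G := G) hN o
  refine ⟨o, (∑ j, |Z o j|) / G.stateDegree o, by positivity, fun w x B hw hx => ?_⟩
  have hs : ‖∑ j, Z o j • w j‖ ≤ (∑ j, |Z o j|) * B := by
    rw [Finset.sum_mul]
    refine norm_sum_le_of_le _ fun j _ => ?_
    rw [norm_smul, Real.norm_eq_abs]
    exact mul_le_mul_of_nonneg_left (hw j) (abs_nonneg _)
  simp only [nodeMap, ho, zero_smul, Finset.sum_const_zero, smul_zero, add_zero, inner_add_left,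
    inner_neg_left, real_inner_smul_left, real_inner_self_eq_norm_sq] at hx
  have h1 := real_inner_le_norm (∑ j, Z o j • w j) (x o)
  rw [div_mul_eq_mul_div, le_div_iff₀ hd]
  rcases (norm_nonneg (x o)).eq_or_lt with h0 | h0
  · rw [← h0, zero_mul]; exact (norm_nonneg _).trans hs
  · refine le_trans ?_ hs
    refine le_of_mul_le_mul_right ?_ h0
    nlinarith

/-- At a constant vector the edge differences vanish, so the required value of `Z z` has zero sum
and lies in the range of `Z`. -/
lemma exists_fixed_point (hN : 2 ≤ N) (hZ : G.IsOntoDecomposition Z) (p : H) (b : Fin N → H)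
    (hb : ∑ i, b i = 0) : ∃ z : Fin (N - 1) → H, ∀ i, nodeMap G Z z (fun _ => p) i = b i := by
  have h0 : ∑ i, (b i - nodeMap G Z 0 (fun _ => p) i) = 0 := by
    rw [Finset.sum_sub_distrib, hb, sum_nodeMap hZ]
    simp
  obtain ⟨z, hz⟩ := hZ.exists_eq_sum hN _ h0
  refine ⟨z, fun i => ?_⟩
  have := hz i
  simp only [nodeMap, Pi.zero_apply, smul_zero, Finset.sum_const_zero, add_zero] at this ⊢
  rw [this]
  abel

/-- Multiplying the resolvent inclusion by `d_i` cancels the node-dependent step size `σ / d_i`. -/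
lemma IsGraphDRS.exists_subgradient (hN : 2 ≤ N) {A : Fin N → H → Set H} {σ : ℝ}
    {θ : ℕ → ℝ} {w : ℕ → Fin (N - 1) → H} {x : ℕ → Fin N → H} (h : IsGraphDRS G Z A σ θ w x)
    (k : ℕ) (i : Fin N) :
    ∃ a ∈ A i (x (k + 1) i), σ • a = nodeMap G Z (w k) (x (k + 1)) i := by
  obtain ⟨a, ha, h1⟩ := h.x_step k i
  refine ⟨a, ha, ?_⟩
  have hd := BilevelGraph.stateDegree_pos (G := G) hN i
  have hs : ∑ l, edgeInd G.stateEdges l i • x (k + 1) l =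
      ∑ l ∈ Finset.univ.filter (fun l => (l, i) ∈ G.stateEdges), x (k + 1) l := by
    rw [Finset.sum_filter]
    simp [edgeInd]
  have h2 := congrArg ((G.stateDegree i : ℝ) • ·) h1
  simp only [smul_add, smul_smul, mul_div_cancel₀ _ hd.ne', one_smul] at h2
  rw [nodeMap, hs, add_assoc, ← h2]
  abel

end Iteration

end GraphDRS

namespace GraphDRS

open Filter Asymptotics

/-! ### Bounds along the iteration and the objective rate. -/

section Rate

variable {N : ℕ} {H : Type*} [NormedAddCommGroup H] [InnerProductSpace ℝ H]
  {G : BilevelGraph N} {Z : Matrix (Fin N) (Fin (N - 1)) ℝ}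

/-- The residual `Zᵀ x`, as an element of the Hilbert sum `H^{N-1}`. -/
noncomputable def residual (Z : Matrix (Fin N) (Fin (N - 1)) ℝ) (x : Fin N → H) :
    PiLp 2 (fun _ : Fin (N - 1) => H) :=
  WithLp.toLp 2 fun j => ∑ i, Z i j • x i

lemma residual_sub (x x' : Fin N → H) : residual Z (x - x') = residual Z x - residual Z x' := by
  ext j
  simp [residual, smul_sub]

lemma residual_const (hZ : G.IsOntoDecomposition Z) (p : H) :
    residual Z (fun _ => p) = 0 := by
  ext j
  simp [residual, ← Finset.sum_smul, hZ.sum_col]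

lemma norm_residual_sq (hZ : G.IsOntoDecomposition Z) (x : Fin N → H) :
    ‖residual Z x‖ ^ 2 = energy G.baseEdges x := by
  rw [PiLp.norm_sq_eq_of_L2, ← hZ.sum_norm_sq]
  rfl

/-- Base energy ≤ state energy ≤ `⟨w, Zᵀx⟩`. Applied to differences, this is firm nonexpansiveness.
-/
lemma norm_residual_sq_le_inner (hZ : G.IsOntoDecomposition Z) (w : Fin (N - 1) → H)
    (x : Fin N → H) (h : ∀ i, 0 ≤ (inner ℝ (nodeMap G Z w x i) (x i) : ℝ)) :
    ‖residual Z x‖ ^ 2 ≤ inner ℝ (WithLp.toLp 2 w) (residual Z x) := by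
  have h1 := sum_inner_nodeMap (G := G) (Z := Z) w x
  have h2 := Finset.sum_nonneg fun i (_ : i ∈ Finset.univ) => h i
  have h3 := energy_mono G.base_subset x
  rw [norm_residual_sq hZ, PiLp.inner_apply]
  simp only [residual]
  linarith

/-- The iterates are bounded, and their differences and the sum of the subgradients are controlled
by a residual of order `o(k^{-1/2})`. -/
lemma IsGraphDRS.exists_bounds (hN : 2 ≤ N) (hZ : G.IsOntoDecomposition Z) {f : Fin N → H → EReal}
    (hf : ∀ i, IsProperConvexLsc (f i)) {p : H} {b : Fin N → H}
    (hb : ∀ i, b i ∈ subdifferential (f i) p) (hb0 : ∑ i, b i = 0) {σ : ℝ} (hσ : 0 < σ) {ε : ℝ}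
    (hε0 : 0 < ε) {θ : ℕ → ℝ} (hθ : ∀ k, θ k ∈ Set.Icc ε (2 - ε)) {w : ℕ → Fin (N - 1) → H}
    {x : ℕ → Fin N → H} (h : IsGraphDRS G Z (fun i => subdifferential (f i)) σ θ w x) :
    ∃ (a : ℕ → Fin N → H) (ρ : ℕ → ℝ) (M : ℝ),
      ρ =o[atTop] (fun k : ℕ => ((k + 1 : ℕ) : ℝ) ^ (-(1 / 2) : ℝ)) ∧ 0 ≤ M ∧
      ∀ k, 0 ≤ ρ k ∧ ρ k ≤ M ∧ (∀ i, a k i ∈ subdifferential (f i) (x (k + 1) i)) ∧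
        (∀ i, ‖x (k + 1) i - p‖ ≤ M) ∧ (∀ i, ‖a k i‖ ≤ M) ∧
        (∀ i l, ‖x (k + 1) i - x (k + 1) l‖ ≤ M * ρ k) ∧ ‖∑ i, a k i‖ ≤ M * ρ k := by
  choose a ha hax using fun k i => h.exists_subgradient hN k i
  obtain ⟨z, hz⟩ := exists_fixed_point hN hZ p (fun i => σ • b i)
    (by rw [← Finset.smul_sum, hb0, smul_zero])
  let W : ℕ → PiLp 2 (fun _ : Fin (N - 1) => H) := fun k => WithLp.toLp 2 (w k)
  let r : ℕ → PiLp 2 (fun _ : Fin (N - 1) => H) := fun k => residual Z (x (k + 1))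
  have hnodez : ∀ k i, nodeMap G Z (w k - z) (x (k + 1) - fun _ => p) i = σ • (a k i - b i) := by
    intro k i
    rw [nodeMap_sub, hz, ← hax, smul_sub]
  have hmonoz : ∀ k i, 0 ≤ (inner ℝ (nodeMap G Z (w k - z) (x (k + 1) - fun _ => p) i)
      ((x (k + 1) - fun _ => p : Fin N → H) i) : ℝ) := by
    intro k i
    rw [hnodez, real_inner_smul_left]
    exact mul_nonneg hσ.le (subdifferential_monotone (hf i) (ha k i) (hb i))
  have hfirm : ∀ k l, ‖r k - r l‖ ^ 2 ≤ inner ℝ (W k - W l) (r k - r l) := by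
    intro k l
    have := norm_residual_sq_le_inner hZ (w k - w l) (x (k + 1) - x (l + 1)) fun i => by
      rw [nodeMap_sub, ← hax, ← hax, ← smul_sub, real_inner_smul_left]
      exact mul_nonneg hσ.le (subdifferential_monotone (hf i) (ha k i) (ha l i))
    rwa [residual_sub, WithLp.toLp_sub] at this
  have hfix : ∀ k, ‖r k‖ ^ 2 ≤ inner ℝ (W k - WithLp.toLp 2 z) (r k) := by
    intro k
    have := norm_residual_sq_le_inner hZ _ _ (hmonoz k)
    rwa [residual_sub, residual_const hZ, sub_zero, WithLp.toLp_sub] at this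
  have hstep : ∀ k, W (k + 1) = W k - θ k • r k := by
    intro k
    ext j
    simp [W, r, residual, h.w_step k j]
  obtain ⟨hbdd, hrate⟩ := relaxed_iteration hε0 hθ hstep hfirm hfix
  set B := ‖W 0 - WithLp.toLp 2 z‖
  have hB : 0 ≤ B := norm_nonneg _
  have hwB : ∀ k j, ‖(w k - z) j‖ ≤ B := fun k j =>
    (PiLp.norm_apply_le (W k - WithLp.toLp 2 z) j).trans (hbdd k)
  have hrB : ∀ k, ‖r k‖ ≤ B := by
    intro k
    have h1 := (hfix k).trans (real_inner_le_norm _ _)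
    rcases (norm_nonneg (r k)).eq_or_lt with h0 | h0
    · rw [← h0]; exact hB
    · refine le_trans (le_of_mul_le_mul_right ?_ h0) (hbdd k)
      rwa [← sq]
  have hdiff : ∀ k i l, ‖x (k + 1) i - x (k + 1) l‖ ≤ N * ‖r k‖ := fun k i l =>
    BilevelGraph.norm_sub_le_of_energy_le (G := G) _ (norm_nonneg _) (norm_residual_sq hZ _).ge i l
  obtain ⟨o, C, hC, ho⟩ := exists_norm_first_le (H := H) hN G Z
  obtain ⟨C', hC', hnode⟩ := exists_norm_nodeMap_le (H := H) G Z
  -- `B` bounds `w - z` and the residual, `C * B` the first node's distance to `p`, and `N * B` the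
  -- distance from any node to the first.
  set D := (1 + C + N) * B
  have hBD : B ≤ D := by
    have : 0 ≤ (C + N) * B := by positivity
    simp only [D]; linarith
  have hD : 0 ≤ D := hB.trans hBD
  have hxD : ∀ k i, ‖x (k + 1) i - p‖ ≤ D := by
    intro k i
    have h1 : ‖x (k + 1) o - p‖ ≤ C * B := ho _ _ B (hwB k) (hmonoz k o)
    have h2 := norm_sub_le_norm_sub_add_norm_sub (x (k + 1) i) (x (k + 1) o) p
    have h3 := hdiff k i o
    have h4 : N * ‖r k‖ ≤ N * B := mul_le_mul_of_nonneg_left (hrB k) N.cast_nonneg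
    simp only [D]; linarith
  have haD : ∀ k i, ‖a k i‖ ≤ C' * D / σ + ∑ i, ‖b i‖ := by
    intro k i
    have h1 := hnode (w k - z) (x (k + 1) - fun _ => p) D (fun j => (hwB k j).trans hBD)
      (hxD k) i
    rw [hnodez, norm_smul, Real.norm_of_nonneg hσ.le] at h1
    have h2 : ‖a k i - b i‖ ≤ C' * D / σ := by rwa [le_div_iff₀ hσ, mul_comm]
    have h3 := Finset.single_le_sum (f := fun i => ‖b i‖) (fun i _ => norm_nonneg _)
      (Finset.mem_univ i)
    have h4 := norm_le_norm_sub_add (a k i) (b i)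
    linarith
  have hsum : ∀ k, ‖∑ i, a k i‖ ≤ N * (N * N) / σ * ‖r k‖ := by
    intro k
    have h1 := norm_sum_nodeMap_le hZ (w k) (x (k + 1)) (hdiff k)
    simp only [← hax, ← Finset.smul_sum] at h1
    rw [norm_smul, Real.norm_of_nonneg hσ.le] at h1
    rw [div_mul_eq_mul_div, le_div_iff₀ hσ]
    linarith
  have hb' : 0 ≤ ∑ i, ‖b i‖ := Finset.sum_nonneg fun i _ => norm_nonneg _
  have hq1 : 0 ≤ C' * D / σ := by positivity
  have hq2 : 0 ≤ (N : ℝ) * (N * N) / σ := by positivity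
  have hN0 : (0 : ℝ) ≤ N := N.cast_nonneg
  refine ⟨a, fun k => ‖r k‖, D + (C' * D / σ + ∑ i, ‖b i‖) + N * (N * N) / σ + N, hrate,
    by positivity, fun k => ⟨norm_nonneg _, ?_, ha k, fun i => ?_, fun i => ?_, fun i l => ?_, ?_⟩⟩
  · linarith [hrB k]
  · linarith [hxD k i]
  · linarith [haD k i]
  · refine (hdiff k i l).trans (mul_le_mul_of_nonneg_right ?_ (norm_nonneg _))
    linarith
  · refine (hsum k).trans (mul_le_mul_of_nonneg_right ?_ (norm_nonneg _))
    linarith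

/-- Points close to the iterates inherit the objective rate, provided that the functions whose own
iterates differ from these points are Lipschitz continuous on bounded sets. -/
lemma objectiveRate_of_close {f : Fin N → H → EReal} (hf : ∀ i, IsProperConvexLsc (f i)) {p : H}
    {b : Fin N → H} (hb : ∀ i, b i ∈ subdifferential (f i) p) (hb0 : ∑ i, b i = 0)
    {x a : ℕ → Fin N → H} {y : ℕ → H} {ρ : ℕ → ℝ} {M : ℝ} (hM : 0 ≤ M)
    (hρ : ρ =o[atTop] (fun k : ℕ => ((k + 1 : ℕ) : ℝ) ^ (-(1 / 2) : ℝ)))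
    (h0 : ∀ k, 0 ≤ ρ k) (hρM : ∀ k, ρ k ≤ M)
    (ha : ∀ k i, a k i ∈ subdifferential (f i) (x (k + 1) i))
    (hx : ∀ k i, ‖x (k + 1) i - p‖ ≤ M) (haM : ∀ k i, ‖a k i‖ ≤ M)
    (hsum : ∀ k, ‖∑ i, a k i‖ ≤ M * ρ k) (hy : ∀ k i, ‖y (k + 1) - x (k + 1) i‖ ≤ M * ρ k)
    (hLip : ∀ i, (∀ k, y (k + 1) = x (k + 1) i) ∨ IsLipschitzOnBounded (f i)) :
    ObjectiveRate (fun z => ∑ i, f i z) y := by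
  rcases isEmpty_or_nonempty (Fin N) with hE | ⟨⟨i₀⟩⟩
  · exact objectiveRate_of_gap_le (C := 0) hf hb hb0 (fun _ i => isEmptyElim i) hρ (by simp)
  -- `y` is within `M ρ_k ≤ M * M` of an iterate, which is within `M` of `p`.
  set R := M + M * M
  have hMR : M ≤ R := by nlinarith
  have hyR : ∀ k, ‖y (k + 1) - p‖ ≤ R := by
    intro k
    have h1 := norm_sub_le_norm_sub_add_norm_sub (y (k + 1)) (x (k + 1) i₀) p
    have h2 := mul_le_mul_of_nonneg_left (hρM k) hM
    simp only [R]
    linarith [hy k i₀, hx k i₀]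
  have hclose : ∀ i, ∃ K : ℝ, ∀ k, f i (y (k + 1)) ≠ ⊤ ∧
      (f i (y (k + 1))).toReal ≤ (f i (x (k + 1) i)).toReal + K * ρ k := by
    intro i
    rcases hLip i with h | ⟨g, hg, hK⟩
    · refine ⟨0, fun k => ?_⟩
      rw [h k]
      exact ⟨ne_top_of_mem_subdifferential (hf i) (ha k i), by simp⟩
    · obtain ⟨K, hK⟩ := hK (Metric.closedBall p R) Metric.isBounded_closedBall
      refine ⟨K * M, fun k => ?_⟩
      simp only [hg, EReal.toReal_coe]
      refine ⟨EReal.coe_ne_top _, ?_⟩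
      have h1 := hK.dist_le_mul (y (k + 1)) (by rw [mem_closedBall_iff_norm]; exact hyR k)
        (x (k + 1) i) (by rw [mem_closedBall_iff_norm]; exact (hx k i).trans hMR)
      rw [dist_eq_norm, dist_eq_norm, Real.norm_eq_abs] at h1
      have h2 := mul_le_mul_of_nonneg_left (hy k i) K.coe_nonneg
      have h3 := le_abs_self (g (y (k + 1)) - g (x (k + 1) i))
      linarith
  choose K hK using hclose
  refine objectiveRate_of_gap_le (C := ∑ i, (K i + M * M) + R * M) hf hb hb0
    (fun k i => (hK i k).1) hρ fun k => ?_
  -- The subgradient inequality at `x_i` is tested at `p`, with `p - x_i = (y - x_i) - (y - p)`. The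
  -- `y - p` part is kept so that summing over `i` produces the small vector `∑ a_i`.
  have hi : ∀ i, (f i (y (k + 1))).toReal - (f i p).toReal ≤
      (K i + M * M) * ρ k + inner ℝ (a k i) (y (k + 1) - p) := by
    intro i
    have h1 := toReal_add_inner_le (hf i) (ha k i) (ne_top_of_mem_subdifferential (hf i) (hb i))
    have h2 := (hK i k).2
    have h3 : (inner ℝ (a k i) (p - x (k + 1) i) : ℝ) =
        inner ℝ (a k i) (y (k + 1) - x (k + 1) i) - inner ℝ (a k i) (y (k + 1) - p) := by
      rw [← inner_sub_right]; congr 1; abel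
    have h4 : -(inner ℝ (a k i) (y (k + 1) - x (k + 1) i) : ℝ) ≤ M * (M * ρ k) :=
      (neg_le_abs _).trans ((abs_real_inner_le_norm _ _).trans
        (mul_le_mul (haM k i) (hy k i) (norm_nonneg _) hM))
    linarith
  have hs : (inner ℝ (∑ i, a k i) (y (k + 1) - p) : ℝ) ≤ M * ρ k * R :=
    (real_inner_le_norm _ _).trans
      (mul_le_mul (hsum k) (hyR k) (norm_nonneg _) (mul_nonneg hM (h0 k)))
  have := Finset.sum_le_sum fun i (_ : i ∈ Finset.univ) => hi i
  rw [Finset.sum_sub_distrib, Finset.sum_add_distrib, ← Finset.sum_mul, ← sum_inner] at this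
  linarith

end Rate

end GraphDRS

theorem proposition3p7 {H : Type*} [NormedAddCommGroup H] [InnerProductSpace ℝ H]
    [CompleteSpace H] (N : ℕ) (hN : 2 ≤ N) (G : GraphDRS.BilevelGraph N)
    (Z : Matrix (Fin N) (Fin (N - 1)) ℝ) (hZ : G.IsOntoDecomposition Z)
    (f : Fin N → H → EReal) (hf : ∀ i, GraphDRS.IsProperConvexLsc (f i))
    (hzer : (GraphDRS.zerSum (fun i => GraphDRS.subdifferential (f i))).Nonempty)
    (σ : ℝ) (hσ : 0 < σ) (ε : ℝ) (hε0 : 0 < ε) (hε1 : ε < 1)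
    (θ : ℕ → ℝ) (hθ : ∀ k, θ k ∈ Set.Icc ε (2 - ε))
    (w : ℕ → Fin (N - 1) → H) (x : ℕ → Fin N → H)
    (hwx : GraphDRS.IsGraphDRS G Z (fun i => GraphDRS.subdifferential (f i)) σ θ w x)
    (j : Fin N) (hLip : ∀ i, i ≠ j → GraphDRS.IsLipschitzOnBounded (f i)) :
    GraphDRS.ObjectiveRate (fun y => ∑ i, f i y) (fun k => x k j) ∧
      (GraphDRS.IsLipschitzOnBounded (f j) →
        GraphDRS.ObjectiveRate (fun y => ∑ i, f i y)
          (fun k => (1 / (N : ℝ)) • ∑ i, x k i)) := by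
  obtain ⟨p, b, hb, hb0⟩ := hzer
  obtain ⟨a, ρ, M, hρ, hM, h⟩ := hwx.exists_bounds hN hZ hf hb hb0 hσ hε0 hθ
  choose h0 hρM ha hx haM hdiff hsum using h
  constructor
  · refine GraphDRS.objectiveRate_of_close hf hb hb0 hM hρ h0 hρM ha hx haM hsum
      (fun k i => hdiff k j i) fun i => ?_
    by_cases hij : i = j
    · subst hij; exact Or.inl fun _ => rfl
    · exact Or.inr (hLip i hij)
  · intro hj
    refine GraphDRS.objectiveRate_of_close hf hb hb0 hM hρ h0 hρM ha hx haM hsum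
      (fun k i => ?_) fun i => ?_
    · have hN0 : (0 : ℝ) < N := by exact_mod_cast (by omega : 0 < N)
      -- The mean minus `x_i` is the mean of the differences `x_l - x_i`, so it inherits the bound
      -- `M ρ_k`.
      have h1 : (1 / (N : ℝ)) • ∑ l, x (k + 1) l - x (k + 1) i =
          (1 / (N : ℝ)) • ∑ l, (x (k + 1) l - x (k + 1) i) := by
        rw [Finset.sum_sub_distrib, smul_sub, Finset.sum_const, Finset.card_fin,
          ← Nat.cast_smul_eq_nsmul ℝ, smul_smul, one_div, inv_mul_cancel₀ hN0.ne', one_smul]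
      have h2 : ‖∑ l, (x (k + 1) l - x (k + 1) i)‖ ≤ N * (M * ρ k) := by
        refine (norm_sum_le_of_le _ fun l _ => hdiff k l i).trans ?_
        simp
      rw [h1, norm_smul, Real.norm_of_nonneg (by positivity), one_div,
        inv_mul_le_iff₀ hN0]
      exact h2
    · by_cases hij : i = j
      · subst hij; exact Or.inr hj
      · exact Or.inr (hLip i hij)
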